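/- **Theorem 3.1 (Comparison theorem for the WLLN).** Let $(\Omega,\mathcal F,\mathbb P)$ be a probability space and let $(\mathbf B,\|\cdot\|)$ be a real separable Banach space with its Borel $\sigma$-algebra; all random variables below are defined on $\Omega$. Let $\{a_n; n\ge 1\}$ and $\{b_n; n\ge 1\}$ be increasing (not necessarily strictly) sequences of positive real numbers such that $\lim_{n\to\infty}a_n=\infty$ and $\{b_n/a_n; n\ge1\}$ is nondecreasing. For a sequence $\{X,X_n;n\ge1\}$ of i.i.d. $\mathbf B$-valued random variables (the $X_n$ are independent and each has the law of $X$), write $$S_n=\sum_{i=1}^nX_i,\qquad \gamma_n=n\,\mathbb E\big(X\,I\{\|X\|\le b_n\}\big),\qquad n\ge1,$$ and call the sequence symmetric if $X$ and $-X$ have the same law. Suppose that for every symmetric sequence $\{X,X_n;n\ge1\}$ of i.i.d. $\mathbf B$-valued random variables, $$\frac{S_n}{a_n}\to_{\mathbb P}0\quad\text{if and only if}\quad\lim_{n\to\infty}n\,\mathbb P(\|X\|>a_n)=0.$$ Then for every sequence $\{X,X_n;n\ge1\}$ of i.i.d. $\mathbf B$-valued random variables: 1. if $\lim_{n\to\infty}n\,\mathbb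 P(\|X\|>b_n)=0$, then $\dfrac{S_n-\gamma_n}{b_n}\to_{\mathbb P}0$; 2. if $\limsup_{n\to\infty}n\,\mathbb P(\|X\|>b_n)>0$, then $\limsup_{n\to\infty}\mathbb P\left(\dfrac{\|S_n-\gamma_n\|}{b_n}>\lambda\right)>0$ for all $\lambda>0$. -/

import Mathlib

open MeasureTheory ProbabilityTheory Filter Topology
open scoped ENNReal

namespace WLLN

variable {Ω B : Type*} [MeasurableSpace Ω]
  [NormedAddCommGroup B] [NormedSpace ℝ B] [MeasurableSpace B]

/-- `{X, X_n; n ≥ 1}` is a sequence of i.i.d. `B`-valued random variables on `(Ω, P)`: the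
`X_n` are independent and each has the law of `X`. The value `Xs i` stands for `X_{i+1}`. -/
structure IsIIDSeq (P : Measure Ω) (X : Ω → B) (Xs : ℕ → Ω → B) : Prop where
  measurable : Measurable X
  measurable_seq : ∀ i, Measurable (Xs i)
  indep : iIndepFun Xs P
  identDistrib : ∀ i, IdentDistrib (Xs i) X P P

/-- `X` is symmetric: `X` and `-X` have the same law. -/
def IsSymmetric (P : Measure Ω) (X : Ω → B) : Prop :=
  IdentDistrib X (fun ω => -X ω) P P

/-- `S_n = X_1 + ⋯ + X_n`. -/
def partialSum (Xs : ℕ → Ω → B) (n : ℕ) (ω : Ω) : B :=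
  ∑ i ∈ Finset.range n, Xs i ω

/-- `γ_n = n E(X 1{‖X‖ ≤ b_n})`. -/
noncomputable def gam (P : Measure Ω) (X : Ω → B) (b : ℕ → ℝ) (n : ℕ) : B :=
  (n : ℝ) • ∫ ω, Set.indicator {ω | ‖X ω‖ ≤ b n} X ω ∂P

/-- `n P(‖X‖ > c_n)`. It is `[0, ∞]`-valued, so that its upper limit always makes sense. -/
noncomputable def tail (P : Measure Ω) (X : Ω → B) (c : ℕ → ℝ) (n : ℕ) : ℝ≥0∞ :=
  (n : ℝ≥0∞) * P {ω | c n < ‖X ω‖}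

end WLLN

/-! Everything rests on moving the symmetric weak law from the scale `a` to the scale `b`. Since `a
n / b n` decreases, there is a radial map `g` taking the ball of radius `b n` into that of radius `a
n` while shrinking no point of it by a factor below `a n / b n` (`exists_scaling`). The tail
condition for `X` at `b` gives the one for `g X` at `a`, so the sums of `g X_i` are negligible
against `a n`. Apart from the rare event that some `‖X_i‖ > b n`, each `(a n / b n) X_i` is `g X_i`
times a coefficient in `[0, 1]`, so the contraction principle gives negligibility of `S_n` against
`b n` (`tendsto_of_isNormalizing`).

For part 1, apply this to the differences `X_{2i} - X_{2i+1}`. By Fubini, `S_n` then concentrates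
near some `c_n`. A bounded i.i.d. real sum that concentrates has small variance, as its
characteristic function shows, so `c_n` must be close to the truncated mean; testing with
functionals, uniformly, identifies `c_n` with `γ_n` up to `o(b n)` (`tendsto_of_symmetrize`).

For part 2, argue by contraposition. Small centered sums at one scale `λ b n` make the symmetrized
sums small, and a symmetric sum dominates its largest term, so the tail condition holds at `K b n`
with `K = 2λ + 1`. The transferred law for `K b` makes the symmetrized sums negligible at every
scale, and the largest-term bound then yields the tail condition at `b n` itself (`tendsto_tail`).
-/

set_option linter.unusedSectionVars false

namespace WLLN

/-! ### Deterministic counting of sign patterns: Lévy's inequality and contraction. -/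

section Signs

variable {B : Type*} [NormedAddCommGroup B]

/-- Changes the sign of the entries of `x` whose index lies in `A`. -/
def signFlip (A : Finset ℕ) (x : ℕ → B) (i : ℕ) : B := if i ∈ A then -x i else x i

lemma norm_signFlip (A : Finset ℕ) (x : ℕ → B) (i : ℕ) : ‖signFlip A x i‖ = ‖x i‖ := by
  unfold signFlip; split_ifs <;> simp

lemma signFlip_insert_self (A : Finset ℕ) (x : ℕ → B) (i : ℕ) :
    signFlip (insert i A) x i = -x i := by simp [signFlip]

lemma signFlip_insert_of_ne {A : Finset ℕ} {x : ℕ → B} {i j : ℕ} (h : j ≠ i) :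
    signFlip (insert i A) x j = signFlip A x j := by simp [signFlip, h]

lemma signFlip_of_notMem {A : Finset ℕ} {x : ℕ → B} {i : ℕ} (h : i ∉ A) :
    signFlip A x i = x i := by simp [signFlip, h]

variable [NormedSpace ℝ B]

lemma signFlip_smul (A : Finset ℕ) (r : B → ℝ) (hr : ∀ y, r (-y) = r y) (x : ℕ → B) (i : ℕ) :
    r (signFlip A x i) • signFlip A x i = signFlip A (fun i => r (x i) • x i) i := by
  unfold signFlip; split_ifs <;> simp [hr]

open Classical in
/-- The number of sign patterns on `s` that satisfy `Q`. -/
noncomputable def signCount (s : Finset ℕ) (Q : Finset ℕ → Prop) : ℕ :=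
  ∑ A ∈ s.powerset, if Q A then 1 else 0

lemma signCount_mono {s : Finset ℕ} {Q R : Finset ℕ → Prop} (h : ∀ A ⊆ s, Q A → R A) :
    signCount s Q ≤ signCount s R := by
  refine Finset.sum_le_sum fun A hA => ?_
  have := h A (Finset.mem_powerset.1 hA)
  split_ifs <;> simp_all

lemma signCount_insert {s : Finset ℕ} {i : ℕ} (hi : i ∉ s) (Q : Finset ℕ → Prop) :
    signCount (insert i s) Q = signCount s Q + signCount s (fun A => Q (insert i A)) :=
  Finset.sum_powerset_insert hi _

lemma signCount_compl (s : Finset ℕ) (Q : Finset ℕ → Prop) :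
    signCount s (fun A => Q (s \ A)) = signCount s Q := by
  refine Finset.sum_nbij' (fun A => s \ A) (fun A => s \ A) ?_ ?_ ?_ ?_ ?_
  · intro A _; simp
  · intro A _; simp
  · intro A hA; simpa using hA
  · intro A hA; simpa using hA
  · intro A _; rfl

lemma signCount_le_two_pow (s : Finset ℕ) (Q : Finset ℕ → Prop) :
    signCount s Q ≤ 2 ^ s.card := by
  rw [← Finset.card_powerset, Finset.card_eq_sum_ones]
  exact Finset.sum_le_sum fun A _ => by split_ifs <;> simp

lemma two_pow_le_signCount_add {s : Finset ℕ} {Q R : Finset ℕ → Prop} (h : ∀ A ⊆ s, Q A ∨ R A) :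
    2 ^ s.card ≤ signCount s Q + signCount s R := by
  rw [← Finset.card_powerset, Finset.card_eq_sum_ones, signCount, signCount,
    ← Finset.sum_add_distrib]
  refine Finset.sum_le_sum fun A hA => ?_
  have := h A (Finset.mem_powerset.1 hA)
  split_ifs <;> simp_all

/-- A random signed sum is at least as long as its constant part for half of the signs. -/
lemma two_pow_le_two_mul_signCount (s : Finset ℕ) (x : ℕ → B) {v : B} {t : ℝ} (hv : t < ‖v‖) :
    2 ^ s.card ≤ 2 * signCount s (fun A => t < ‖v + ∑ i ∈ s, signFlip A x i‖) := by
  rw [two_mul]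
  -- Pair each pattern with its opposite: `v` is the midpoint of `v + w` and `v - w`, so one of the
  -- two is at least as long as `v`.
  nth_rewrite 2 [← signCount_compl]
  refine two_pow_le_signCount_add fun A hA => ?_
  have hneg : ∑ i ∈ s, signFlip (s \ A) x i = -∑ i ∈ s, signFlip A x i := by
    rw [← Finset.sum_neg_distrib]
    refine Finset.sum_congr rfl fun i hi => ?_
    by_cases h : i ∈ A <;> simp [signFlip, h, hi]
  rw [hneg]
  by_contra! hcon
  set w := ∑ i ∈ s, signFlip A x i
  have h2 : (2 : ℝ) • v = (v + w) + (v + -w) := by rw [two_smul]; abel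
  have := norm_add_le (v + w) (v + -w)
  rw [← h2, norm_smul] at this
  norm_num at this
  linarith [hcon.1, hcon.2]

/-- Lévy's maximal inequality for signed sums, along the upper level sets of `c`. -/
lemma signCount_levy (c : ℕ → ℝ) (x : ℕ → B) (t : ℝ) (s : Finset ℕ) (v : B) :
    signCount s (fun A => ∃ u : ℝ, t < ‖v + ∑ i ∈ s with u ≤ c i, signFlip A x i‖) ≤
      2 * signCount s (fun A => t < ‖v + ∑ i ∈ s, signFlip A x i‖) := by
  -- Adding the index with the largest `c` means that any nonempty level set contains it, so its
  -- signed term can be absorbed into `v`; this is why `v` is generalized. An empty level set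
  -- matters only when `‖v‖ > t`.
  induction s using Finset.induction_on_max_value c generalizing v with
  | empty =>
    simp only [Finset.filter_empty, Finset.sum_empty, exists_const]
    omega
  | insert a s ha hmax ih =>
    by_cases hv : t < ‖v‖
    · exact (signCount_le_two_pow _ _).trans (two_pow_le_two_mul_signCount _ x hv)
    have key : ∀ A : Finset ℕ, (∃ u : ℝ, t < ‖v + ∑ i ∈ insert a s with u ≤ c i, signFlip A x i‖) →
        ∃ u : ℝ, t < ‖(v + signFlip A x a) + ∑ i ∈ s with u ≤ c i, signFlip A x i‖ := by
      rintro A ⟨u, hu⟩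
      by_cases hua : u ≤ c a
      · refine ⟨u, ?_⟩
        rwa [Finset.filter_insert, if_pos hua, Finset.sum_insert (by simp [ha]), ← add_assoc] at hu
      · rw [Finset.filter_eq_empty_iff.2] at hu
        · simp at hu; exact absurd hu hv
        · intro i hi
          rcases Finset.mem_insert.1 hi with rfl | hi
          · exact hua
          · exact fun h => hua (h.trans (hmax i hi))
    refine (signCount_mono fun A _ => key A).trans ?_
    rw [signCount_insert ha, signCount_insert ha, mul_add]
    refine add_le_add ?_ ?_
    · refine le_trans (signCount_mono fun A hA => ?_) ((ih (v + x a)).trans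
        (Nat.mul_le_mul_left 2 (signCount_mono fun A hA => ?_)))
      · rw [signFlip_of_notMem fun h => ha (hA h)]; exact id
      · rw [Finset.sum_insert ha, signFlip_of_notMem fun h => ha (hA h), add_assoc]; exact id
    · have hs : ∀ A, ∀ i ∈ s, signFlip (insert a A) x i = signFlip A x i := fun A i hi =>
        signFlip_insert_of_ne fun h => ha (h ▸ hi)
      refine le_trans (signCount_mono fun A hA => ?_) ((ih (v + -x a)).trans
        (Nat.mul_le_mul_left 2 (signCount_mono fun A hA => ?_)))
      · rintro ⟨u, hu⟩
        refine ⟨u, ?_⟩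
        rwa [signFlip_insert_self,
          Finset.sum_congr rfl fun i hi => hs A i (Finset.mem_filter.1 hi).1] at hu
      · rw [Finset.sum_insert ha, signFlip_insert_self, Finset.sum_congr rfl (hs A), add_assoc]
        exact id

/-- Layer cake: `c i` is the integral over `u` in `[0, 1]` of the indicator of `u ≤ c i`, so the
weighted sum is an average of the level-set sums and cannot be longer than all of them. -/
lemma exists_lt_norm_sum_filter [CompleteSpace B] {c : ℕ → ℝ} {s : Finset ℕ}
    (hc0 : ∀ i ∈ s, 0 ≤ c i) (hc1 : ∀ i ∈ s, c i ≤ 1) {y : ℕ → B} {t : ℝ}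
    (h : t < ‖∑ i ∈ s, c i • y i‖) : ∃ u : ℝ, t < ‖∑ i ∈ s with u ≤ c i, y i‖ := by
  by_contra! hcon
  have hinteg : ∀ i ∈ s, IntervalIntegrable (fun u : ℝ => (Set.Iic (c i)).indicator (1 : ℝ → ℝ) u)
      volume 0 1 := fun i _ => by
    have : IntegrableOn (fun _ : ℝ => (1 : ℝ)) (Set.uIoc 0 1) := by
      simp [integrableOn_const_iff, Set.uIoc]
    exact intervalIntegrable_iff.2 (this.indicator measurableSet_Iic)
  have hval : ∀ i ∈ s, ∫ u in (0 : ℝ)..1, (Set.Iic (c i)).indicator (1 : ℝ → ℝ) u = c i :=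
    fun i hi => by
    rw [intervalIntegral.integral_of_le zero_le_one, setIntegral_indicator measurableSet_Iic,
      Set.Ioc_inter_Iic, min_eq_right (hc1 i hi)]
    simp [hc0 i hi]
  have hsum : ∑ i ∈ s, c i • y i = ∫ u in (0 : ℝ)..1, ∑ i ∈ s with u ≤ c i, y i := by
    have : (fun u : ℝ => ∑ i ∈ s with u ≤ c i, y i) =
        fun u => ∑ i ∈ s, (Set.Iic (c i)).indicator (1 : ℝ → ℝ) u • y i := by
      ext u
      rw [Finset.sum_filter]
      refine Finset.sum_congr rfl fun i _ => ?_
      by_cases hu : u ≤ c i <;> simp [Set.indicator, hu]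
    rw [this, intervalIntegral.integral_finsetSum fun i hi =>
      ⟨(hinteg i hi).1.smul_const _, (hinteg i hi).2.smul_const _⟩]
    refine Finset.sum_congr rfl fun i hi => ?_
    rw [intervalIntegral.integral_smul_const, hval i hi]
  have := intervalIntegral.norm_integral_le_of_norm_le_const (a := (0 : ℝ)) (b := 1)
    (f := fun u : ℝ => ∑ i ∈ s with u ≤ c i, y i) (C := t) fun u _ => hcon u
  rw [← hsum] at this
  simp at this
  linarith

/-- The contraction principle for tails of signed sums. -/
lemma signCount_contraction [CompleteSpace B] {c : ℕ → ℝ} {s : Finset ℕ}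
    (hc0 : ∀ i ∈ s, 0 ≤ c i) (hc1 : ∀ i ∈ s, c i ≤ 1) (x : ℕ → B) (t : ℝ) :
    signCount s (fun A => t < ‖∑ i ∈ s, c i • signFlip A x i‖) ≤
      2 * signCount s (fun A => t < ‖∑ i ∈ s, signFlip A x i‖) := by
  have := signCount_levy c x t s 0
  simp only [zero_add] at this
  exact (signCount_mono fun A _ h => exists_lt_norm_sum_filter hc0 hc1 h).trans this

/-- If one term is long, then so is the signed sum for half of the signs. -/
lemma signCount_single_le [CompleteSpace B] (s : Finset ℕ) (x : ℕ → B) (t : ℝ) :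
    signCount s (fun A => ∃ i ∈ s, t < ‖signFlip A x i‖) ≤
      2 * signCount s (fun A => t < ‖∑ i ∈ s, signFlip A x i‖) := by
  by_cases h : ∃ i ∈ s, t < ‖x i‖
  · obtain ⟨i, hi, hit⟩ := h
    refine le_trans (signCount_mono fun A _ _ => ?_) (signCount_contraction
      (c := fun j => if j = i then 1 else 0) (by intros; positivity)
      (by intro j _; split_ifs <;> simp) x t)
    simp only [ite_smul, one_smul, zero_smul, Finset.sum_ite_eq', hi, if_true, norm_signFlip, hit]
  · refine (Nat.eq_zero_of_le_zero ?_).trans_le (Nat.zero_le _)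
    refine (Finset.sum_eq_zero fun A _ => if_neg ?_).le
    simpa [norm_signFlip] using h

end Signs

/-! ### From sign counts to probabilities. -/

section SignInvariance

variable {Ω B : Type*} [MeasurableSpace Ω] {P : Measure Ω} [NormedAddCommGroup B]
  [MeasurableSpace B] [BorelSpace B]

lemma measurable_signFlip (A : Finset ℕ) : Measurable (signFlip A : (ℕ → B) → ℕ → B) := by
  refine measurable_pi_lambda _ fun i => ?_
  unfold signFlip
  split_ifs <;> fun_prop

lemma identDistrib_signFlip {V : ℕ → Ω → B} (hind : iIndepFun V P)
    (hsym : ∀ i, IsSymmetric P (V i)) (A : Finset ℕ) :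
    IdentDistrib (fun ω i => V i ω) (fun ω => signFlip A (fun i => V i ω)) P P := by
  have hfl : ∀ i, Measurable (fun y : B => if i ∈ A then -y else y) := fun i => by
    split_ifs <;> fun_prop
  refine IdentDistrib.pi (Y := fun i ω => if i ∈ A then -V i ω else V i ω) (fun i => ?_) hind
    (hind.comp (fun i y => if i ∈ A then -y else y) hfl)
  by_cases h : i ∈ A
  · simpa [h, IsSymmetric] using hsym i
  · simpa [h] using IdentDistrib.refl (hsym i).aemeasurable_fst

open Classical in
/-- A comparison of events that holds when counting sign patterns holds in probability. -/
lemma measure_le_two_mul_of_signCount_le {V : ℕ → Ω → B} (hV : ∀ i, Measurable (V i))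
    (hind : iIndepFun V P) (hsym : ∀ i, IsSymmetric P (V i)) (s : Finset ℕ)
    {E F : Set (ℕ → B)} (hE : MeasurableSet E) (hF : MeasurableSet F)
    (h : ∀ x, signCount s (fun A => signFlip A x ∈ E) ≤
      2 * signCount s (fun A => signFlip A x ∈ F)) :
    P {ω | (fun i => V i ω) ∈ E} ≤ 2 * P {ω | (fun i => V i ω) ∈ F} := by
  have hVm : Measurable (fun ω i => V i ω) := measurable_pi_lambda _ hV
  -- All sign flips of `V` have the same law, so averaging over them turns a probability into an
  -- expected count, and the pointwise comparison `h` can be integrated.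
  have hcount : ∀ G : Set (ℕ → B), MeasurableSet G →
      (2 : ℝ≥0∞) ^ s.card * P {ω | (fun i => V i ω) ∈ G} =
        ∫⁻ ω, (signCount s (fun A => signFlip A (fun i => V i ω) ∈ G) : ℝ≥0∞) ∂P := by
    intro G hG
    have hm : ∀ A, MeasurableSet {ω | signFlip A (fun i => V i ω) ∈ G} := fun A =>
      ((measurable_signFlip A).comp hVm) hG
    simp only [signCount, Nat.cast_sum, Nat.cast_ite, Nat.cast_one, Nat.cast_zero]
    rw [lintegral_finsetSum _ fun A _ => Measurable.ite (hm A) measurable_const measurable_const]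
    have : ∀ A ∈ s.powerset, ∫⁻ ω, (if signFlip A (fun i => V i ω) ∈ G then 1 else 0 : ℝ≥0∞) ∂P =
        P {ω | (fun i => V i ω) ∈ G} := by
      intro A _
      refine Eq.trans ?_ ((identDistrib_signFlip hind hsym A).measure_mem_eq hG).symm
      exact lintegral_indicator_one (hm A)
    rw [Finset.sum_congr rfl this]
    simp
  have hpow0 : (2 : ℝ≥0∞) ^ s.card ≠ 0 := by positivity
  have hpowt : (2 : ℝ≥0∞) ^ s.card ≠ ∞ := by simp
  rw [← ENNReal.mul_le_mul_iff_right hpow0 hpowt, mul_left_comm, hcount E hE, hcount F hF,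
    ← lintegral_const_mul' _ _ (by simp)]
  refine lintegral_mono fun ω => ?_
  have := Nat.cast_le (α := ℝ≥0∞).2 (h fun i => V i ω)
  rwa [Nat.cast_mul, Nat.cast_ofNat] at this

end SignInvariance

/-- From `1 - q ≤ exp (-np)` and `np + 1 ≤ exp (np)` one gets `(1 - q)(np + 1) ≤ 1`. This serves
both for variances and for the tail of a single term. -/
lemma nat_mul_le_two_mul_of_le_pow {n : ℕ} {p q : ℝ} (hp0 : 0 ≤ p) (hp1 : p ≤ 1) (hq : q ≤ 1 / 2)
    (h : 1 - q ≤ (1 - p) ^ n) : n * p ≤ 2 * q := by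
  have h1 : (1 - p) ^ n ≤ Real.exp (-(n * p)) := by
    rw [← mul_neg, Real.exp_nat_mul]
    exact pow_le_pow_left₀ (by linarith) (Real.one_sub_le_exp_neg p) n
  have h2 : n * p + 1 ≤ Real.exp (n * p) := Real.add_one_le_exp _
  have h3 : Real.exp (-(n * p)) * Real.exp (n * p) = 1 := by rw [← Real.exp_add]; simp
  have hnp : 0 ≤ n * p := by positivity
  have h4 : (1 - q) * (n * p + 1) ≤ 1 := by
    refine (mul_le_mul (h.trans h1) h2 (by positivity) (Real.exp_nonneg _)).trans_eq h3
  nlinarith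

/-! ### Real bounded variables: concentration of a sum locates its mean. -/

section Centering

variable {Ω : Type*} [MeasurableSpace Ω] {P : Measure Ω} [IsProbabilityMeasure P]

/-- The characteristic function of a bounded variable at `1` is controlled by the variance. -/
lemma norm_integral_exp_le_one_sub_variance {ξ : Ω → ℝ} (hm : Measurable ξ)
    (hb : ∀ ω, |ξ ω| ≤ 1) :
    ‖∫ ω, Complex.exp (ξ ω * Complex.I) ∂P‖ ≤ 1 - 2 / Real.pi ^ 2 * variance ξ P := by
  set z := ∫ ω, Complex.exp (ξ ω * Complex.I) ∂P with hz
  have hinteg : Integrable (fun ω => Complex.exp (ξ ω * Complex.I)) P := by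
    refine Integrable.of_bound (by fun_prop) 1 (ae_of_all _ fun ω => ?_)
    rw [Complex.norm_exp_ofReal_mul_I]
  -- Positivity of the real part puts the argument `θ` in `(-π/2, π/2)`, so `|ξ - θ| ≤ 1 + π/2 ≤ π`,
  -- the range where the quadratic bound on the cosine is valid.
  have hre : 0 < z.re := by
    have h1 : z.re = ∫ ω, Real.cos (ξ ω) ∂P := by
      rw [hz, ← RCLike.re_eq_complex_re, ← integral_re hinteg]
      simp [Complex.exp_ofReal_mul_I_re]
    rw [h1]
    have hc : ∀ ω, Real.cos 1 ≤ Real.cos (ξ ω) := fun ω => by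
      rw [← Real.cos_abs (ξ ω)]
      exact Real.cos_le_cos_of_nonneg_of_le_pi (abs_nonneg _) (by linarith [Real.pi_gt_three]) (hb ω)
    have : ∫ _, Real.cos 1 ∂P ≤ ∫ ω, Real.cos (ξ ω) ∂P := by
      refine integral_mono (integrable_const _) ?_ hc
      exact Integrable.of_bound (by fun_prop) 1 (ae_of_all _ fun ω => Real.abs_cos_le_one _)
    simp at this
    linarith [Real.cos_one_pos]
  set θ := Complex.arg z
  have hθ : |θ| < Real.pi / 2 := Complex.abs_arg_lt_pi_div_two_iff.2 (Or.inl hre)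
  have hd : ∀ ω, |ξ ω - θ| ≤ Real.pi := fun ω => by
    have := abs_sub (ξ ω) θ
    linarith [hb ω, Real.pi_gt_three]
  have hnorm : ‖z‖ = ∫ ω, Real.cos (ξ ω - θ) ∂P := by
    have h1 : (‖z‖ : ℂ) = ∫ ω, Complex.exp ((ξ ω - θ : ℝ) * Complex.I) ∂P := by
      have h2 : (‖z‖ : ℂ) = Complex.exp (-(θ * Complex.I)) * z := by
        conv_rhs => rw [← Complex.norm_mul_exp_arg_mul_I z]
        rw [mul_left_comm, ← Complex.exp_add]
        simp [θ]
      rw [h2, hz, ← integral_const_mul]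
      congr 1 with ω
      rw [← Complex.exp_add]
      congr 1
      push_cast
      ring
    have h3 : ‖z‖ = (∫ ω, Complex.exp ((ξ ω - θ : ℝ) * Complex.I) ∂P).re := by
      rw [← h1, Complex.ofReal_re]
    rw [h3, ← RCLike.re_eq_complex_re, ← integral_re]
    · simp only [RCLike.re_eq_complex_re, Complex.exp_ofReal_mul_I_re]
    · refine Integrable.of_bound (by fun_prop) 1 (ae_of_all _ fun ω => ?_)
      rw [Complex.norm_exp_ofReal_mul_I]
  have hsq : Integrable (fun ω => (ξ ω - θ) ^ 2) P := by
    refine Integrable.of_bound (by fun_prop) (Real.pi ^ 2) (ae_of_all _ fun ω => ?_)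
    rw [Real.norm_eq_abs, abs_pow]
    exact pow_le_pow_left₀ (abs_nonneg _) (hd ω) 2
  have hle : ‖z‖ ≤ ∫ ω, (1 - 2 / Real.pi ^ 2 * (ξ ω - θ) ^ 2) ∂P := by
    rw [hnorm]
    refine integral_mono ?_ ((integrable_const _).sub (hsq.const_mul _)) fun ω =>
      Real.cos_le_one_sub_mul_cos_sq (hd ω)
    exact Integrable.of_bound (by fun_prop) 1 (ae_of_all _ fun ω => Real.abs_cos_le_one _)
  rw [integral_sub (integrable_const _) (hsq.const_mul _), integral_const_mul] at hle
  simp only [integral_const, probReal_univ, smul_eq_mul, mul_one] at hle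
  have hvar : variance ξ P ≤ ∫ ω, (ξ ω - θ) ^ 2 ∂P := by
    have h1 : variance (fun ω => ξ ω - θ) P = variance ξ P :=
      variance_sub_const hm.aestronglyMeasurable θ
    rw [← h1]
    exact variance_le_expectation_sq (by fun_prop)
  have : 0 ≤ 2 / Real.pi ^ 2 := by positivity
  nlinarith

/-- If a sum of i.i.d. variables with values in `[-1, 1]` is close to `d` with high probability,
then so is its mean. -/
lemma exists_forall_abs_mul_integral_sub_le {ε : ℝ} (hε : 0 < ε) :
    ∃ δ : ℝ, 0 < δ ∧ δ ≤ ε ∧ ∀ (n : ℕ) (ξ : ℕ → Ω → ℝ) (ξ₀ : Ω → ℝ) (d : ℝ),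
      (∀ i, Measurable (ξ i)) → Measurable ξ₀ → iIndepFun ξ P →
      (∀ i, IdentDistrib (ξ i) ξ₀ P P) → (∀ i ω, |ξ i ω| ≤ 1) → (∀ ω, |ξ₀ ω| ≤ 1) →
      P.real {ω | δ < |∑ i ∈ Finset.range n, ξ i ω - d|} ≤ δ → |n * ∫ ω, ξ₀ ω ∂P - d| ≤ ε := by
  set k : ℝ := 2 / Real.pi ^ 2 with hk
  have hkpos : 0 < k := by positivity
  -- The bound `1/6` makes `3δ ≤ 1/2`. The last bound turns `n k Var ξ₀ ≤ 6δ` into `Var T ≤ ε²/16`,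
  -- so that Chebyshev at distance `ε/2` costs at most `1/4`. The choice ignores `n`, `ξ` and `d`,
  -- which gives uniformity over functionals later.
  set δ := min (min (ε / 2) (1 / 6)) (k * ε ^ 2 / 96) with hδ
  have hδpos : 0 < δ := by positivity
  have hδ1 : δ ≤ ε / 2 := (min_le_left _ _).trans (min_le_left _ _)
  have hδ2 : δ ≤ 1 / 6 := (min_le_left _ _).trans (min_le_right _ _)
  have hδ3 : δ ≤ k * ε ^ 2 / 96 := min_le_right _ _
  refine ⟨δ, hδpos, by linarith, fun n ξ ξ₀ d hm hm₀ hind hid hb hb₀ hP => ?_⟩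
  set T : Ω → ℝ := fun ω => ∑ i ∈ Finset.range n, ξ i ω with hT
  have hTm : Measurable T := Finset.measurable_sum _ fun i _ => hm i
  set z := ∫ ω, Complex.exp (ξ₀ ω * Complex.I) ∂P with hz
  have hV0 : 0 ≤ variance ξ₀ P := variance_nonneg _ _
  have hzle : ‖z‖ ≤ 1 - k * variance ξ₀ P := norm_integral_exp_le_one_sub_variance hm₀ hb₀
  have hpow : ∫ ω, Complex.exp (T ω * Complex.I) ∂P = z ^ n := by
    have h1 := (hind.precomp (g := fun i : Fin n => (i : ℕ)) Fin.val_injective).integral_fun_prod_comp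
      (f := fun _ x => Complex.exp ((x : ℝ) * Complex.I)) (fun i => (hm i).aemeasurable)
      (fun i => by fun_prop)
    have h2 : ∀ i, ∫ ω, Complex.exp (ξ i ω * Complex.I) ∂P = z := fun i =>
      ((hid i).comp (u := fun x : ℝ => Complex.exp (x * Complex.I)) (by fun_prop)).integral_eq
    simp only [h2, Finset.prod_const, Finset.card_univ, Fintype.card_fin] at h1
    rw [← h1]
    congr 1 with ω
    rw [← Complex.exp_sum, ← Finset.sum_mul]
    simp only [hT, Finset.sum_range]
    push_cast
    rfl
  set E := {ω | δ < |T ω - d|} with hE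
  have hEm : MeasurableSet E := measurableSet_lt measurable_const (by fun_prop)
  -- `exp (i(T - d))` is within `δ` of `1` off `E` and within `2` on `E`, where `P E ≤ δ`.
  have hlow : 1 - 3 * δ ≤ ‖z‖ ^ n := by
    have hinteg : Integrable (fun ω => Complex.exp ((T ω - d : ℝ) * Complex.I)) P := by
      refine Integrable.of_bound (by fun_prop) 1 (ae_of_all _ fun ω => ?_)
      rw [Complex.norm_exp_ofReal_mul_I]
    have h1 : ∫ ω, Complex.exp ((T ω - d : ℝ) * Complex.I) ∂P =
        Complex.exp (-(d * Complex.I)) * z ^ n := by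
      rw [← hpow, ← integral_const_mul]
      congr 1 with ω
      rw [← Complex.exp_add]
      congr 1
      push_cast
      ring
    have h2 : ‖Complex.exp (-(d * Complex.I)) * z ^ n‖ = ‖z‖ ^ n := by
      rw [norm_mul, norm_pow, ← neg_mul, ← Complex.ofReal_neg, Complex.norm_exp_ofReal_mul_I,
        one_mul]
    have h3 : ‖∫ ω, (Complex.exp ((T ω - d : ℝ) * Complex.I) - 1) ∂P‖ ≤
        ∫ ω, (δ + E.indicator (fun _ => 2) ω) ∂P := by
      refine norm_integral_le_of_norm_le ((integrable_const _).add
        ((integrable_const _).indicator hEm)) (ae_of_all _ fun ω => ?_)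
      by_cases hω : ω ∈ E
      · rw [Set.indicator_of_mem hω]
        refine (norm_sub_le _ _).trans ?_
        rw [Complex.norm_exp_ofReal_mul_I, norm_one]
        linarith
      · rw [Set.indicator_of_notMem hω, add_zero]
        have := Real.norm_exp_I_mul_ofReal_sub_one_le (x := T ω - d)
        rw [mul_comm] at this
        exact this.trans (not_lt.1 hω)
    rw [integral_sub hinteg (integrable_const _), h1,
      integral_add (integrable_const _) ((integrable_const _).indicator hEm),
      integral_indicator_const _ hEm] at h3
    simp only [integral_const, probReal_univ, one_smul, smul_eq_mul, one_mul] at h3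
    have h4 := norm_sub_norm_le (1 : ℂ) (Complex.exp (-(d * Complex.I)) * z ^ n)
    rw [norm_sub_rev, h2, norm_one] at h4
    linarith
  have hkV : k * variance ξ₀ P ≤ 1 := by linarith [norm_nonneg z]
  have hnV : n * (k * variance ξ₀ P) ≤ 2 * (3 * δ) :=
    nat_mul_le_two_mul_of_le_pow (by positivity) hkV (by linarith)
      (hlow.trans (pow_le_pow_left₀ (norm_nonneg _) hzle n))
  have hL2 : ∀ i, MemLp (ξ i) 2 P := fun i =>
    MemLp.of_bound (hm i).aestronglyMeasurable 1 (ae_of_all _ (hb i))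
  have hTL2 : MemLp T 2 P := memLp_finsetSum _ fun i _ => hL2 i
  have hvar : variance T P = n * variance ξ₀ P := by
    have h1 : T = ∑ i ∈ Finset.range n, ξ i := by ext ω; simp [hT]
    rw [h1, IndepFun.variance_sum (fun i _ => hL2 i) fun i _ j _ hij => hind.indepFun hij,
      Finset.sum_congr rfl fun i _ => (hid i).variance_eq]
    simp
  have hmean : ∫ ω, T ω ∂P = n * ∫ ω, ξ₀ ω ∂P := by
    rw [hT, integral_finsetSum _ fun i _ => (hL2 i).integrable one_le_two,
      Finset.sum_congr rfl fun i _ => (hid i).integral_eq]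
    simp
  have hcheb : P.real {ω | ε / 2 ≤ |T ω - ∫ ω, T ω ∂P|} ≤ 1 / 4 := by
    have h1 := meas_ge_le_variance_div_sq hTL2 (half_pos hε)
    have h2 : variance T P / (ε / 2) ^ 2 ≤ 1 / 4 := by
      rw [div_le_iff₀ (by positivity), hvar]
      have : k * (n * variance ξ₀ P) ≤ k * (ε ^ 2 / 16) := by linarith
      have := le_of_mul_le_mul_left this hkpos
      linarith
    refine ENNReal.toReal_le_of_le_ofReal (by norm_num) (h1.trans (ENNReal.ofReal_le_ofReal h2))
  -- The claim is deterministic, so a single outcome outside both exceptional events, of total mass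
  -- at most `1/6 + 1/4`, suffices.
  obtain ⟨ω, hω⟩ : ∃ ω, ω ∉ E ∪ {ω | ε / 2 ≤ |T ω - ∫ ω, T ω ∂P|} := by
    by_contra! hcon
    have h1 := measureReal_union_le (μ := P) E {ω | ε / 2 ≤ |T ω - ∫ ω, T ω ∂P|}
    rw [Set.eq_univ_of_forall hcon, probReal_univ] at h1
    linarith
  simp only [hE, Set.mem_union, Set.mem_ofPred_eq, not_or, not_lt, not_le] at hω
  rw [← hmean]
  have := abs_sub_le (∫ ω, T ω ∂P) (T ω) d
  rw [abs_sub_comm _ (T ω)] at this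
  linarith [hω.1, hω.2]

end Centering

/-! ### Symmetrization of i.i.d. sequences. -/

section IID

variable {Ω B C : Type*} [MeasurableSpace Ω] {P : Measure Ω} [IsProbabilityMeasure P]
  [NormedAddCommGroup B] [MeasurableSpace B]

lemma iIndepFun_prodMk_even_odd {X : ℕ → Ω → B} (hX : ∀ i, Measurable (X i))
    (h : iIndepFun X P) : iIndepFun (fun i ω => (X (2 * i) ω, X (2 * i + 1) ω)) P := by
  classical
  rw [iIndepFun_iff_measure_inter_preimage_eq_mul]
  intro S sets hsets
  induction S using Finset.induction_on with
  | empty => simp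
  | insert j S hj ih =>
    rw [Finset.set_biInter_insert, Finset.prod_insert hj,
      ← ih fun i hi => hsets i (Finset.mem_insert_of_mem hi)]
    set m : ℕ → MeasurableSpace Ω := fun k => MeasurableSpace.comap (X k) inferInstance
    have hm : ∀ (T : Set ℕ) (i : ℕ), 2 * i ∈ T → 2 * i + 1 ∈ T →
        Measurable[⨆ k ∈ T, m k] (fun ω => (X (2 * i) ω, X (2 * i + 1) ω)) := by
      intro T i h0 h1
      have hle : ∀ k ∈ T, Measurable[⨆ k ∈ T, m k] (X k) := fun k hk =>
        (comap_measurable (X k)).mono (le_iSup₂_of_le k hk le_rfl) le_rfl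
      exact (hle _ h0).prodMk (hle _ h1)
    have hdisj : Disjoint ({2 * j, 2 * j + 1} : Set ℕ) {k | k / 2 ∈ S} := by
      rw [Set.disjoint_left]
      rintro k (rfl | rfl) hk
      · exact hj (by simpa using hk)
      · exact hj (by simpa [show (2 * j + 1) / 2 = j by omega] using hk)
    have hI := indep_iSup_of_disjoint (fun k => (hX k).comap_le) h.iIndep hdisj
    refine (Indep_iff _ _ P).1 hI _ _ ?_ ?_
    · exact hm _ j (by simp) (by simp) (hsets j (Finset.mem_insert_self _ _))
    · refine Finset.measurableSet_biInter _ fun i hi => ?_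
      refine hm {k | k / 2 ∈ S} i (by simpa using hi) ?_ (hsets i (Finset.mem_insert_of_mem hi))
      simpa [show (2 * i + 1) / 2 = i by omega] using hi

variable {X : Ω → B} {Xs : ℕ → Ω → B}

lemma IsIIDSeq.comp [MeasurableSpace C]
    (h : IsIIDSeq P X Xs) {g : B → C} (hg : Measurable g) :
    IsIIDSeq P (fun ω => g (X ω)) (fun i ω => g (Xs i ω)) where
  measurable := hg.comp h.measurable
  measurable_seq i := hg.comp (h.measurable_seq i)
  indep := h.indep.comp (fun _ => g) fun _ => hg
  identDistrib i := (h.identDistrib i).comp hg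

lemma IsIIDSeq.identDistrib_pair (h : IsIIDSeq P X Xs) {i j k l : ℕ} (hij : i ≠ j) (hkl : k ≠ l) :
    IdentDistrib (fun ω => (Xs i ω, Xs j ω)) (fun ω => (Xs k ω, Xs l ω)) P P :=
  ((h.identDistrib i).trans (h.identDistrib k).symm).prodMk
    ((h.identDistrib j).trans (h.identDistrib l).symm) (h.indep.indepFun hij)
    (h.indep.indepFun hkl)

lemma IsIIDSeq.identDistrib_precomp (h : IsIIDSeq P X Xs) {g : ℕ → ℕ} (hg : g.Injective) :
    IdentDistrib (fun ω i => Xs (g i) ω) (fun ω i => Xs i ω) P P :=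
  IdentDistrib.pi (fun i => (h.identDistrib (g i)).trans (h.identDistrib i).symm)
    (h.indep.precomp hg) h.indep

variable [BorelSpace B] [SecondCountableTopology B]

/-- Pairing even and odd terms supplies the independent copy inside the given sequence, so `Ω` need
not be enlarged and the hypothesis on `Ω` still applies. -/
lemma IsIIDSeq.symmetrize (h : IsIIDSeq P X Xs) :
    IsIIDSeq P (fun ω => Xs 0 ω - Xs 1 ω) (fun i ω => Xs (2 * i) ω - Xs (2 * i + 1) ω) where
  measurable := (h.measurable_seq 0).sub (h.measurable_seq 1)
  measurable_seq i := (h.measurable_seq _).sub (h.measurable_seq _)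
  indep := (iIndepFun_prodMk_even_odd h.measurable_seq h.indep).comp (fun _ p => p.1 - p.2)
    fun _ => by fun_prop
  identDistrib i := (h.identDistrib_pair (by omega) zero_ne_one).comp
    (u := fun p : B × B => p.1 - p.2) (by fun_prop)

lemma IsIIDSeq.isSymmetric_sub (h : IsIIDSeq P X Xs) :
    IsSymmetric P (fun ω => Xs 0 ω - Xs 1 ω) := by
  have := (h.identDistrib_pair zero_ne_one one_ne_zero).comp
    (u := fun p : B × B => p.1 - p.2) (by fun_prop)
  simpa [IsSymmetric, Function.comp_def] using this

lemma IsSymmetric.congr {Y : Ω → B} (hX : IsSymmetric P X) (h : IdentDistrib Y X P P) :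
    IsSymmetric P Y :=
  h.trans (hX.trans (h.comp (u := fun y : B => -y) (by fun_prop)).symm)

lemma measurable_partialSum (h : ∀ i, Measurable (Xs i)) (n : ℕ) :
    Measurable (partialSum Xs n) :=
  Finset.measurable_sum _ fun i _ => h i

lemma IsIIDSeq.identDistrib_partialSum (h : IsIIDSeq P X Xs) {g : ℕ → ℕ} (hg : g.Injective)
    (n : ℕ) : IdentDistrib (partialSum (fun i => Xs (g i)) n) (partialSum Xs n) P P :=
  (h.identDistrib_precomp hg).comp (u := fun x : ℕ → B => ∑ i ∈ Finset.range n, x i) (by fun_prop)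

lemma IsIIDSeq.indepFun_partialSum (h : IsIIDSeq P X Xs) (n : ℕ) :
    IndepFun (partialSum (fun i => Xs (2 * i)) n) (partialSum (fun i => Xs (2 * i + 1)) n) P := by
  set m : ℕ → MeasurableSpace Ω := fun k => MeasurableSpace.comap (Xs k) inferInstance
  have hdisj : Disjoint {k : ℕ | k % 2 = 0} {k : ℕ | k % 2 = 1} := by
    rw [Set.disjoint_left]
    intro k (h0 : k % 2 = 0) (h1 : k % 2 = 1)
    omega
  have hI := indep_iSup_of_disjoint (fun k => (h.measurable_seq k).comap_le) h.indep.iIndep hdisj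
  have hm : ∀ (T : Set ℕ) (g : ℕ → ℕ), (∀ i, g i ∈ T) →
      Measurable[⨆ k ∈ T, m k] (partialSum (fun i => Xs (g i)) n) := fun T g hg =>
    Finset.measurable_sum _ fun i _ =>
      (comap_measurable (Xs (g i))).mono (le_iSup₂_of_le (g i) (hg i) le_rfl) le_rfl
  rw [IndepFun_iff_Indep]
  exact indep_of_indep_of_le_right (indep_of_indep_of_le_left hI
    (hm _ _ fun i => by simp).comap_le) (hm _ _ fun i => by simp).comap_le

lemma partialSum_sub (Ys Zs : ℕ → Ω → B) (n : ℕ) (ω : Ω) :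
    partialSum (fun i ω => Ys i ω - Zs i ω) n ω = partialSum Ys n ω - partialSum Zs n ω :=
  Finset.sum_sub_distrib _ _

/-- A sum is concentrated around some point at least as well as its symmetrization is around `0`. -/
lemma IsIIDSeq.exists_measure_le_symmetrize (h : IsIIDSeq P X Xs) (n : ℕ) (r : ℝ) :
    ∃ c : B, P {ω | r < ‖partialSum Xs n ω - c‖} ≤
      P {ω | r < ‖partialSum (fun i ω => Xs (2 * i) ω - Xs (2 * i + 1) ω) n ω‖} := by
  set U := partialSum (fun i => Xs (2 * i)) n
  set W := partialSum (fun i => Xs (2 * i + 1)) n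
  have hU : Measurable U := measurable_partialSum (fun i => h.measurable_seq _) n
  have hW : Measurable W := measurable_partialSum (fun i => h.measurable_seq _) n
  have hset : MeasurableSet {p : B × B | r < ‖p.2 - p.1‖} :=
    measurableSet_lt measurable_const (by fun_prop)
  have hprod := (indepFun_iff_map_prod_eq_prod_map_map hW.aemeasurable hU.aemeasurable).1
    (h.indepFun_partialSum n).symm
  have hWP : IsProbabilityMeasure (P.map W) := Measure.isProbabilityMeasure_map hW.aemeasurable
  have hmeas := measurable_measure_prodMk_left (ν := P.map U) hset
  -- Conditioning on the odd sum: some value `c` of it does no worse than the average.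
  obtain ⟨c, hc⟩ := exists_le_lintegral (μ := P.map W) hmeas.aemeasurable
  refine ⟨c, ?_⟩
  rw [← Measure.prod_apply hset, ← hprod, Measure.map_apply (hW.prodMk hU) hset,
    Measure.map_apply hU (measurable_prodMk_left hset)] at hc
  have hs : MeasurableSet {y : B | r < ‖y - c‖} := measurableSet_lt measurable_const (by fun_prop)
  have heq := (h.identDistrib_partialSum (g := fun i => 2 * i)
    (fun i j hij => by simpa using hij) n).measure_mem_eq hs
  refine heq.symm.trans_le (hc.trans_eq ?_)
  congr 1 with ω
  simp [partialSum_sub, U, W]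

lemma IsIIDSeq.measure_exists_le (h : IsIIDSeq P X Xs) (n : ℕ) (s : ℝ) :
    P {ω | ∃ i ∈ Finset.range n, s < ‖Xs i ω‖} ≤ n * P {ω | s < ‖X ω‖} := by
  have hs : MeasurableSet {y : B | s < ‖y‖} := measurableSet_lt measurable_const (by fun_prop)
  have hU : {ω | ∃ i ∈ Finset.range n, s < ‖Xs i ω‖} =
      ⋃ i ∈ Finset.range n, {ω | s < ‖Xs i ω‖} := by ext; simp
  rw [hU]
  refine (measure_biUnion_finset_le _ _).trans_eq ?_
  have : ∀ i ∈ Finset.range n, P {ω | s < ‖Xs i ω‖} = P {ω | s < ‖X ω‖} :=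
    fun i _ => (h.identDistrib i).measure_mem_eq hs
  rw [Finset.sum_congr rfl this]
  simp

/-- If a symmetric sum is unlikely to exceed `s`, then so is each of its terms. -/
lemma IsIIDSeq.nat_mul_measure_le [NormedSpace ℝ B] [CompleteSpace B]
    (h : IsIIDSeq P X Xs) (hsym : IsSymmetric P X) (n : ℕ) (s : ℝ) (hsmall : P {ω | s < ‖partialSum Xs n ω‖} ≤ 1 / 4) :
    n * P {ω | s < ‖X ω‖} ≤ 4 * P {ω | s < ‖partialSum Xs n ω‖} := by
  have hs : MeasurableSet {y : B | s < ‖y‖} := measurableSet_lt measurable_const (by fun_prop)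
  have hsE : MeasurableSet {x : ℕ → B | ∃ i ∈ Finset.range n, s < ‖x i‖} := by
    have : {x : ℕ → B | ∃ i ∈ Finset.range n, s < ‖x i‖} =
      ⋃ i ∈ Finset.range n, {x : ℕ → B | s < ‖x i‖} := by ext; simp
    rw [this]
    exact Finset.measurableSet_biUnion _ fun i _ => measurableSet_lt measurable_const (by fun_prop)
  have hmax : P {ω | ∃ i ∈ Finset.range n, s < ‖Xs i ω‖} ≤
      2 * P {ω | s < ‖partialSum Xs n ω‖} :=
    measure_le_two_mul_of_signCount_le h.measurable_seq h.indep
      (fun i => hsym.congr (h.identDistrib i)) (Finset.range n) hsE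
      (F := {x | s < ‖∑ i ∈ Finset.range n, x i‖})
      (measurableSet_lt measurable_const (by fun_prop)) fun x => signCount_single_le _ x s
  set p := P.real {ω | s < ‖X ω‖} with hp
  set q := P.real {ω | ∃ i ∈ Finset.range n, s < ‖Xs i ω‖} with hq
  set u := P.real {ω | s < ‖partialSum Xs n ω‖} with hu
  have hqu : q ≤ 2 * u := by
    have := ENNReal.toReal_mono (by finiteness) hmax
    rwa [ENNReal.toReal_mul, ENNReal.toReal_ofNat] at this
  have hu4 : u ≤ 1 / 4 := by
    have := ENNReal.toReal_mono (by finiteness) hsmall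
    simpa [hu, measureReal_def] using this
  have hcompl : 1 - q = (1 - p) ^ n := by
    have h1 : 1 - q = P.real (⋂ i ∈ Finset.range n, Xs i ⁻¹' {y : B | s < ‖y‖}ᶜ) := by
      rw [hq, ← probReal_compl_eq_one_sub]
      · congr 1 with ω
        simp
      · exact (measurable_pi_lambda _ h.measurable_seq) hsE
    have h2 : ∀ i ∈ Finset.range n, P (Xs i ⁻¹' {y : B | s < ‖y‖}ᶜ) = P (X ⁻¹' {y : B | s < ‖y‖}ᶜ) :=
      fun i _ => (h.identDistrib i).measure_mem_eq hs.compl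
    rw [h1, measureReal_def, h.indep.measure_inter_preimage_eq_mul _ fun i _ => hs.compl,
      Finset.prod_congr rfl h2, Finset.prod_const, Finset.card_range, ENNReal.toReal_pow,
      Set.preimage_compl, ← measureReal_def, probReal_compl_eq_one_sub (h.measurable hs)]
    rfl
  -- The threshold `1/4` in `hsmall` ensures `q ≤ 2u ≤ 1/2`.
  have hnp : n * p ≤ 2 * q := nat_mul_le_two_mul_of_le_pow measureReal_nonneg measureReal_le_one
    (by linarith) hcompl.le
  have : ENNReal.ofReal (n * p) ≤ ENNReal.ofReal (4 * u) := ENNReal.ofReal_le_ofReal (by linarith)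
  rw [ENNReal.ofReal_mul (by positivity), ENNReal.ofReal_mul (by positivity), hp, hu,
    ofReal_measureReal, ofReal_measureReal] at this
  simpa using this

lemma exists_half_le_measure_norm_le (X : Ω → B) :
    ∃ M : ℝ, 1 / 2 ≤ P {ω | ‖X ω‖ ≤ M} := by
  have hmono : Monotone fun k : ℕ => {ω | ‖X ω‖ ≤ k} := fun k l hkl ω (hω : ‖X ω‖ ≤ k) =>
    hω.trans (by exact_mod_cast hkl)
  have hlim := tendsto_measure_iUnion_atTop (μ := P) hmono
  have huniv : ⋃ k : ℕ, {ω | ‖X ω‖ ≤ k} = Set.univ :=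
    Set.eq_univ_of_forall fun ω => Set.mem_iUnion.2 (exists_nat_ge ‖X ω‖)
  rw [huniv, measure_univ] at hlim
  obtain ⟨k, hk⟩ := (hlim.eventually (lt_mem_nhds (show (1 / 2 : ℝ≥0∞) < 1 by
    simp))).exists
  exact ⟨k, hk.le⟩

/-- The tail of `X` is controlled by the tail of its symmetrization. -/
lemma IsIIDSeq.measure_le_two_mul_symmetrize (h : IsIIDSeq P X Xs) {M : ℝ}
    (hM : 1 / 2 ≤ P {ω | ‖X ω‖ ≤ M}) (s : ℝ) :
    P {ω | s + M < ‖X ω‖} ≤ 2 * P {ω | s < ‖Xs 0 ω - Xs 1 ω‖} := by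
  have hs : MeasurableSet {y : B | s + M < ‖y‖} := measurableSet_lt measurable_const (by fun_prop)
  have hm : MeasurableSet {y : B | ‖y‖ ≤ M} := measurableSet_le (by fun_prop) measurable_const
  have hind := (h.indep.indepFun zero_ne_one).measure_inter_preimage_eq_mul _ _ hs hm
  rw [(h.identDistrib 0).measure_mem_eq hs, (h.identDistrib 1).measure_mem_eq hm] at hind
  have hsub : P (Xs 0 ⁻¹' {y | s + M < ‖y‖} ∩ Xs 1 ⁻¹' {y | ‖y‖ ≤ M}) ≤
      P {ω | s < ‖Xs 0 ω - Xs 1 ω‖} := by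
    refine measure_mono ?_
    rintro ω ⟨h0 : s + M < ‖Xs 0 ω‖, h1 : ‖Xs 1 ω‖ ≤ M⟩
    have := norm_sub_norm_le (Xs 0 ω) (Xs 1 ω)
    change s < _
    linarith
  rw [hind] at hsub
  calc P {ω | s + M < ‖X ω‖} = 2 * (P {ω | s + M < ‖X ω‖} * (1 / 2)) := by
        rw [mul_left_comm, one_div, ENNReal.mul_inv_cancel two_ne_zero ENNReal.ofNat_ne_top, mul_one]
    _ ≤ 2 * P {ω | s < ‖Xs 0 ω - Xs 1 ω‖} := by
        gcongr
        exact le_trans (mul_le_mul_right hM _) hsub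

/-- The tail of a symmetrization is controlled by the tail of `X`. -/
lemma IsIIDSeq.measure_symmetrize_le (h : IsIIDSeq P X Xs) (s : ℝ) :
    P {ω | 2 * s < ‖Xs 0 ω - Xs 1 ω‖} ≤ 2 * P {ω | s < ‖X ω‖} := by
  have hs : MeasurableSet {y : B | s < ‖y‖} := measurableSet_lt measurable_const (by fun_prop)
  have hsub : {ω | 2 * s < ‖Xs 0 ω - Xs 1 ω‖} ⊆
      Xs 0 ⁻¹' {y | s < ‖y‖} ∪ Xs 1 ⁻¹' {y | s < ‖y‖} := by
    intro ω (hω : 2 * s < ‖Xs 0 ω - Xs 1 ω‖)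
    by_contra hcon
    simp only [Set.mem_union, Set.mem_preimage, Set.mem_ofPred_eq, not_or, not_lt] at hcon
    linarith [norm_sub_le (Xs 0 ω) (Xs 1 ω), hcon.1, hcon.2]
  refine (measure_mono hsub).trans ((measure_union_le _ _).trans_eq ?_)
  rw [(h.identDistrib 0).measure_mem_eq hs, (h.identDistrib 1).measure_mem_eq hs, two_mul]
  rfl

end IID

/-! ### Normalizing sequences and the radial rescaling. -/

/-- The hypotheses of the comparison theorem on the normalizing sequences. -/
structure IsNormalizing (a b : ℕ → ℝ) : Prop where
  pos_left : ∀ n, 1 ≤ n → 0 < a n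
  pos_right : ∀ n, 1 ≤ n → 0 < b n
  mono_left : MonotoneOn a (Set.Ici 1)
  tendsto_left : Tendsto a atTop atTop
  mono_div : MonotoneOn (fun n => b n / a n) (Set.Ici 1)

namespace IsNormalizing

variable {a b : ℕ → ℝ}

lemma tendsto_right (h : IsNormalizing a b) : Tendsto b atTop atTop := by
  have h1 : Tendsto (fun n => b 1 / a 1 * a n) atTop atTop :=
    h.tendsto_left.const_mul_atTop (div_pos (h.pos_right 1 le_rfl) (h.pos_left 1 le_rfl))
  refine tendsto_atTop_mono' _ ?_ h1
  filter_upwards [eventually_ge_atTop 1] with n hn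
  have := h.mono_div (Set.mem_Ici.2 le_rfl) (Set.mem_Ici.2 hn) hn
  exact (le_div_iff₀ (h.pos_left n hn)).1 this

/-- Lets the transferred law be run at constant multiples of `b`, as symmetrization doubles the
scale and part 2 enlarges it. -/
lemma const_mul (h : IsNormalizing a b) {c : ℝ} (hc : 0 < c) :
    IsNormalizing a (fun n => c * b n) where
  pos_left := h.pos_left
  pos_right n hn := mul_pos hc (h.pos_right n hn)
  mono_left := h.mono_left
  tendsto_left := h.tendsto_left
  mono_div := fun m hm n hn hmn => by
    simp only [mul_div_assoc]
    exact mul_le_mul_of_nonneg_left (h.mono_div hm hn hmn) hc.le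

lemma div_le_div (h : IsNormalizing a b) {m n : ℕ} (hm : 1 ≤ m) (hmn : m ≤ n) :
    a n / b n ≤ a m / b m := by
  have hn := hm.trans hmn
  have := h.mono_div (Set.mem_Ici.2 hm) (Set.mem_Ici.2 hn) hmn
  rw [← inv_div (b n), ← inv_div (b m)]
  exact inv_anti₀ (div_pos (h.pos_right m hm) (h.pos_left m hm)) this

/-- A radial rescaling that carries the ball of radius `b n` into the ball of radius `a n`
and contracts that ball by a factor of at least `a n / b n`. -/
lemma exists_scaling (h : IsNormalizing a b) :
    ∃ r : ℝ → ℝ, Measurable r ∧ (∀ x, 0 < r x) ∧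
      ∀ x n, 1 ≤ n → x ≤ b n → r x * x ≤ a n ∧ a n / b n ≤ r x := by
  classical
  have hex : ∀ x, ∃ n, 1 ≤ n ∧ x ≤ b n := fun x =>
    ((eventually_ge_atTop 1).and (h.tendsto_right.eventually_ge_atTop x)).exists
  set N : ℝ → ℕ := fun x => Nat.find (hex x)
  have hN : ∀ x, 1 ≤ N x ∧ x ≤ b (N x) := fun x => Nat.find_spec (hex x)
  have hNle : ∀ x n, 1 ≤ n → x ≤ b n → N x ≤ n := fun x n h1 h2 => Nat.find_min' (hex x) ⟨h1, h2⟩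
  refine ⟨fun x => a (N x) / b (N x), ?_, fun x => ?_, fun x n hn hx => ⟨?_, ?_⟩⟩
  -- The least admissible index grows with `x` and `a / b` decreases along indices, so monotonicity
  -- gives measurability.
  · refine Antitone.measurable fun x y hxy => ?_
    exact h.div_le_div (hN x).1 (hNle x _ (hN y).1 (hxy.trans (hN y).2))
  · exact div_pos (h.pos_left _ (hN x).1) (h.pos_right _ (hN x).1)
  · have hpos := h.pos_right _ (hN x).1
    have hle := h.mono_left (Set.mem_Ici.2 (hN x).1) (Set.mem_Ici.2 hn) (hNle x n hn hx)
    refine le_trans ?_ hle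
    rw [div_mul_eq_mul_div, div_le_iff₀ hpos]
    exact mul_le_mul_of_nonneg_left (hN x).2 (h.pos_left _ (hN x).1).le
  · exact h.div_le_div (hN x).1 (hNle x n hn hx)

end IsNormalizing

/-! ### Transfer of the weak law, centering, and the converse. -/

section

variable {Ω B : Type*} [MeasurableSpace Ω] {P : Measure Ω} [IsProbabilityMeasure P]
  [NormedAddCommGroup B] [NormedSpace ℝ B] [MeasurableSpace B]

lemma tendstoInMeasure_inv_smul_iff {c : ℕ → ℝ} (hc : ∀ n, 1 ≤ n → 0 < c n) (F : ℕ → Ω → B) :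
    TendstoInMeasure P (fun n ω => (c n)⁻¹ • F n ω) atTop (fun _ => 0) ↔
      ∀ t : ℝ, 0 < t → Tendsto (fun n => P {ω | t * c n < ‖F n ω‖}) atTop (𝓝 0) := by
  rw [tendstoInMeasure_iff_norm]
  have hn : ∀ n, 1 ≤ n → ∀ ω, ‖(c n)⁻¹ • F n ω - 0‖ = ‖F n ω‖ / c n := fun n hn ω => by
    rw [sub_zero, norm_smul, norm_inv, Real.norm_of_nonneg (hc n hn).le, inv_mul_eq_div]
  constructor
  · intro h t ht
    refine tendsto_of_tendsto_of_tendsto_of_le_of_le' tendsto_const_nhds (h t ht)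
      (Eventually.of_forall fun _ => zero_le) ?_
    filter_upwards [eventually_ge_atTop 1] with n h1
    refine measure_mono fun ω hω => ?_
    rw [Set.mem_ofPred_eq] at hω
    change t ≤ _
    rw [hn n h1, le_div_iff₀ (hc n h1)]
    exact hω.le
  · intro h t ht
    -- Halving `t` passes from the non-strict inequality in `TendstoInMeasure` to a strict one.
    refine tendsto_of_tendsto_of_tendsto_of_le_of_le' tendsto_const_nhds (h (t / 2) (half_pos ht))
      (Eventually.of_forall fun _ => zero_le) ?_
    filter_upwards [eventually_ge_atTop 1] with n h1
    refine measure_mono fun ω hω => ?_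
    rw [Set.mem_ofPred_eq] at hω
    rw [hn n h1, le_div_iff₀ (hc n h1)] at hω
    rw [Set.mem_ofPred_eq]
    have := hc n h1
    nlinarith

variable [BorelSpace B] [SecondCountableTopology B] [CompleteSpace B]

/-- The sufficient half of the weak law for symmetric sequences, normalized by `a`. -/
def SymmetricWeakLaw (P : Measure Ω) (B : Type*) [NormedAddCommGroup B] [NormedSpace ℝ B]
    [MeasurableSpace B] (a : ℕ → ℝ) : Prop :=
  ∀ (X : Ω → B) (Xs : ℕ → Ω → B), IsIIDSeq P X Xs → IsSymmetric P X →
    Tendsto (tail P X a) atTop (𝓝 0) →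
    TendstoInMeasure P (fun n ω => (a n)⁻¹ • partialSum Xs n ω) atTop (fun _ => 0)

variable {a b : ℕ → ℝ} {X : Ω → B} {Xs : ℕ → Ω → B}

/-- The symmetric weak law carries over from the normalization `a` to `b`. -/
lemma SymmetricWeakLaw.tendsto_of_isNormalizing (hw : SymmetricWeakLaw P B a)
    (hab : IsNormalizing a b) (h : IsIIDSeq P X Xs) (hsym : IsSymmetric P X)
    (htail : Tendsto (tail P X b) atTop (𝓝 0)) {t : ℝ} (ht : 0 < t) :
    Tendsto (fun n => P {ω | t * b n < ‖partialSum Xs n ω‖}) atTop (𝓝 0) := by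
  obtain ⟨r, hrm, hrpos, hr⟩ := hab.exists_scaling
  set g : B → B := fun y => r ‖y‖ • y with hg
  have hgm : Measurable g := by
    have : Measurable fun y : B => r ‖y‖ := hrm.comp measurable_norm
    fun_prop
  have hgnorm : ∀ y, ‖g y‖ = r ‖y‖ * ‖y‖ := fun y => by
    rw [hg, norm_smul, Real.norm_of_nonneg (hrpos _).le]
  have hY := h.comp hgm
  have hYsym : IsSymmetric P (fun ω => g (X ω)) := by
    have := IdentDistrib.comp hsym hgm
    simpa [IsSymmetric, Function.comp_def, hg] using this
  have hYtail : Tendsto (tail P (fun ω => g (X ω)) a) atTop (𝓝 0) := by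
    refine tendsto_of_tendsto_of_tendsto_of_le_of_le' tendsto_const_nhds htail
      (Eventually.of_forall fun _ => zero_le) ?_
    filter_upwards [eventually_ge_atTop 1] with n hn
    refine mul_le_mul_right (measure_mono fun ω (hω : a n < ‖g (X ω)‖) => ?_) _
    change b n < ‖X ω‖
    by_contra! hcon
    rw [hgnorm] at hω
    exact absurd (hr _ n hn hcon).1 (not_le.2 hω)
  have hYlim := (tendstoInMeasure_inv_smul_iff hab.pos_left _).1 (hw _ _ hY hYsym hYtail) t ht
  have hsum : Tendsto (fun n => tail P X b n +
      2 * P {ω | t * a n < ‖partialSum (fun i ω => g (Xs i ω)) n ω‖}) atTop (𝓝 0) := by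
    simpa using htail.add (ENNReal.Tendsto.const_mul hYlim (Or.inr ENNReal.ofNat_ne_top))
  refine tendsto_of_tendsto_of_tendsto_of_le_of_le' tendsto_const_nhds hsum
    (Eventually.of_forall fun _ => zero_le) ?_
  filter_upwards [eventually_ge_atTop 1] with n hn
  have han := hab.pos_left n hn
  have hbn := hab.pos_right n hn
  -- The coefficient with `c y • g y = (a n / b n) • y` on the ball. It depends on `‖y‖` alone, so
  -- sign flips leave it fixed and contraction applies despite its being random.
  set c : B → ℝ := fun y => if ‖y‖ ≤ b n then a n / b n / r ‖y‖ else 0 with hc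
  have hcm : Measurable c := by
    have : Measurable fun y : B => r ‖y‖ := hrm.comp measurable_norm
    exact Measurable.ite (measurableSet_le (by fun_prop) measurable_const) (by fun_prop)
      measurable_const
  have hc0 : ∀ y, 0 ≤ c y := fun y => by
    simp only [hc]
    split_ifs
    · exact div_nonneg (div_nonneg han.le hbn.le) (hrpos _).le
    · exact le_rfl
  have hc1 : ∀ y, c y ≤ 1 := fun y => by
    simp only [hc]
    split_ifs with hy
    · exact (div_le_one (hrpos _)).2 (hr _ n hn hy).2
    · exact zero_le_one
  have hcg : ∀ y, ‖y‖ ≤ b n → c y • g y = (a n / b n) • y := fun y hy => by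
    simp only [hc, hg, if_pos hy, smul_smul]
    rw [div_mul_cancel₀ _ (hrpos _).ne']
  have hcontr : P {ω | t * a n < ‖∑ i ∈ Finset.range n, c (Xs i ω) • g (Xs i ω)‖} ≤
      2 * P {ω | t * a n < ‖partialSum (fun i ω => g (Xs i ω)) n ω‖} := by
    refine measure_le_two_mul_of_signCount_le h.measurable_seq h.indep
      (fun i => hsym.congr (h.identDistrib i)) (Finset.range n)
      (E := {x | t * a n < ‖∑ i ∈ Finset.range n, c (x i) • g (x i)‖})
      (F := {x | t * a n < ‖∑ i ∈ Finset.range n, g (x i)‖})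
      (measurableSet_lt measurable_const (by fun_prop))
      (measurableSet_lt measurable_const (by fun_prop)) fun x => ?_
    have hgf : ∀ A i, g (signFlip A x i) = signFlip A (fun i => g (x i)) i := fun A i =>
      signFlip_smul A (fun y => r ‖y‖) (fun y => by simp) x i
    have hcf : ∀ A i, c (signFlip A x i) = c (x i) := fun A i => by
      simp only [hc, norm_signFlip]
    simp only [Set.mem_ofPred_eq, hgf, hcf]
    exact signCount_contraction (fun i _ => hc0 _) (fun i _ => hc1 _) _ _
  refine le_trans ?_ (add_le_add (h.measure_exists_le n (b n)) hcontr)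
  refine le_trans (measure_mono fun ω hω => ?_) (measure_union_le _ _)
  rw [Set.mem_ofPred_eq] at hω
  by_cases hbig : ∃ i ∈ Finset.range n, b n < ‖Xs i ω‖
  · exact Or.inl hbig
  · right
    push Not at hbig
    rw [Set.mem_ofPred_eq]
    rw [Finset.sum_congr rfl fun i hi => hcg _ (hbig i hi), ← Finset.smul_sum, norm_smul,
      Real.norm_of_nonneg (div_pos han hbn).le, div_mul_eq_mul_div, lt_div_iff₀ hbn]
    have := mul_lt_mul_of_pos_left hω han
    rw [partialSum] at this
    linarith

lemma integrable_indicator_norm_le (hX : Measurable X) (s : ℝ) :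
    Integrable (Set.indicator {ω | ‖X ω‖ ≤ s} X) P := by
  have hm : MeasurableSet {ω | ‖X ω‖ ≤ s} := measurableSet_le hX.norm measurable_const
  refine Integrable.of_bound (hX.indicator hm).aestronglyMeasurable |s| (ae_of_all _ fun ω => ?_)
  by_cases hω : ω ∈ {ω | ‖X ω‖ ≤ s}
  · rw [Set.indicator_of_mem hω]
    exact le_trans hω (le_abs_self s)
  · rw [Set.indicator_of_notMem hω, norm_zero]
    exact abs_nonneg s

/-- If the symmetrized sums are negligible and `X` exceeds `b n` rarely, then the truncated means
are the right centering. -/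
lemma IsIIDSeq.tendsto_of_symmetrize (h : IsIIDSeq P X Xs) (hb : ∀ n, 1 ≤ n → 0 < b n)
    (htail : Tendsto (tail P X b) atTop (𝓝 0))
    (hsymm : ∀ t : ℝ, 0 < t → Tendsto (fun n => P {ω | t * b n <
      ‖partialSum (fun i ω => Xs (2 * i) ω - Xs (2 * i + 1) ω) n ω‖}) atTop (𝓝 0))
    {t : ℝ} (ht : 0 < t) :
    Tendsto (fun n => P {ω | t * b n < ‖partialSum Xs n ω - gam P X b n‖}) atTop (𝓝 0) := by
  obtain ⟨δ, hδ, hδt, hcenter⟩ := exists_forall_abs_mul_integral_sub_le (P := P) (half_pos ht)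
  refine tendsto_of_tendsto_of_tendsto_of_le_of_le' tendsto_const_nhds (hsymm δ hδ)
    (Eventually.of_forall fun _ => zero_le) ?_
  have hδ2 : (0 : ℝ≥0∞) < ENNReal.ofReal (δ / 2) := ENNReal.ofReal_pos.2 (half_pos hδ)
  filter_upwards [eventually_ge_atTop 1, (hsymm δ hδ).eventually (ge_mem_nhds hδ2),
    htail.eventually (ge_mem_nhds hδ2)] with n hn hn1 hn2
  have hbn := hb n hn
  obtain ⟨c, hc⟩ := h.exists_measure_le_symmetrize n (δ * b n)
  refine le_trans (measure_mono fun ω hω => ?_) hc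
  rw [Set.mem_ofPred_eq] at hω
  rw [Set.mem_ofPred_eq]
  suffices hγ : ‖gam P X b n - c‖ ≤ t / 2 * b n by
    have h1 : partialSum Xs n ω - gam P X b n = (partialSum Xs n ω - c) - (gam P X b n - c) := by
      abel
    have h2 := norm_sub_le (partialSum Xs n ω - c) (gam P X b n - c)
    rw [← h1] at h2
    nlinarith
  set τ : B → B := fun y => Set.indicator {y : B | ‖y‖ ≤ b n} id y with hτ
  have hτm : Measurable τ := measurable_id.indicator (measurableSet_le (by fun_prop) measurable_const)
  have hτb : ∀ y, ‖τ y‖ ≤ b n := fun y => by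
    by_cases hy : ‖y‖ ≤ b n <;> simp [hτ, Set.indicator, hy, hbn.le]
  have hgam : gam P X b n = (n : ℝ) • ∫ ω, τ (X ω) ∂P := rfl
  have hτint : Integrable (fun ω => τ (X ω)) P := integrable_indicator_norm_le h.measurable (b n)
  -- By Hahn–Banach it suffices to test against functionals; `δ` is the same for all of them.
  refine NormedSpace.norm_le_dual_bound ℝ _ (by positivity) fun f => ?_
  rcases eq_or_ne f 0 with rfl | hf
  · simp
  have hfpos : 0 < ‖f‖ := norm_pos_iff.2 hf
  set κ := ‖f‖ * b n with hκ
  have hκpos : 0 < κ := mul_pos hfpos hbn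
  set u : B → ℝ := fun y => f (τ y) / κ with hu
  have hum : Measurable u := (f.continuous.measurable.comp hτm).div_const κ
  have hub : ∀ y, |u y| ≤ 1 := fun y => by
    rw [hu, abs_div, abs_of_pos hκpos, div_le_one hκpos]
    exact (f.le_opNorm _).trans (mul_le_mul_of_nonneg_left (hτb y) hfpos.le)
  have hiid := h.comp hum
  have hclose : P.real {ω | δ < |∑ i ∈ Finset.range n, u (Xs i ω) - f c / κ|} ≤ δ := by
    refine ENNReal.toReal_le_of_le_ofReal hδ.le ?_
    rw [← add_halves δ, ENNReal.ofReal_add (half_pos hδ).le (half_pos hδ).le, add_halves]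
    -- Half of the budget `δ` pays for a term escaping truncation, the other half for `S_n` being
    -- far from `c`.
    refine le_trans ?_ (add_le_add ((h.measure_exists_le n (b n)).trans hn2) (hc.trans hn1))
    refine le_trans (measure_mono fun ω hω => ?_) (measure_union_le _ _)
    rw [Set.mem_ofPred_eq] at hω
    by_cases hbig : ∃ i ∈ Finset.range n, b n < ‖Xs i ω‖
    · exact Or.inl hbig
    · right
      push Not at hbig
      rw [Set.mem_ofPred_eq]
      have h1 : ∑ i ∈ Finset.range n, u (Xs i ω) = f (partialSum Xs n ω) / κ := by
        rw [partialSum, map_sum, Finset.sum_div]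
        refine Finset.sum_congr rfl fun i hi => ?_
        simp [hu, hτ, Set.indicator, hbig i hi]
      rw [h1, ← sub_div, ← map_sub, abs_div, abs_of_pos hκpos, lt_div_iff₀ hκpos] at hω
      have h2 := hω.trans_le (f.le_opNorm _)
      rw [hκ, mul_left_comm] at h2
      exact lt_of_mul_lt_mul_left h2 hfpos.le
  have hfin := hcenter n _ _ (f c / κ) hiid.measurable_seq hiid.measurable hiid.indep
    hiid.identDistrib (fun i ω => hub _) (fun ω => hub _) hclose
  have hinteg : ∫ ω, u (X ω) ∂P = f (∫ ω, τ (X ω) ∂P) / κ := by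
    simp only [hu]
    rw [integral_div, ContinuousLinearMap.integral_comp_comm f hτint]
  have hfg : n * ∫ ω, u (X ω) ∂P - f c / κ = f (gam P X b n - c) / κ := by
    rw [hinteg, hgam, map_sub, map_smul, smul_eq_mul]
    ring
  rw [hfg, abs_div, abs_of_pos hκpos, div_le_iff₀ hκpos] at hfin
  rw [Real.norm_eq_abs]
  linarith

lemma IsIIDSeq.tendsto_tail_symmetrize (h : IsIIDSeq P X Xs)
    (htail : Tendsto (tail P X b) atTop (𝓝 0)) :
    Tendsto (tail P (fun ω => Xs 0 ω - Xs 1 ω) (fun n => 2 * b n)) atTop (𝓝 0) := by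
  have h2 : Tendsto (fun n => 2 * tail P X b n) atTop (𝓝 0) := by
    simpa using ENNReal.Tendsto.const_mul htail (Or.inr (ENNReal.ofNat_ne_top (n := 2)))
  refine tendsto_of_tendsto_of_tendsto_of_le_of_le tendsto_const_nhds h2
    (fun _ => zero_le) fun n => ?_
  simp only [tail]
  rw [mul_left_comm]
  exact mul_le_mul_right (h.measure_symmetrize_le (b n)) _

/-- The differences have their tail controlled at `2 * b n`, so the law is applied to that
normalization, with `t / 2` to compensate. -/
lemma SymmetricWeakLaw.tendsto_symmetrize (hw : SymmetricWeakLaw P B a)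
    (hab : IsNormalizing a b) (h : IsIIDSeq P X Xs)
    (htail : Tendsto (tail P X b) atTop (𝓝 0)) {t : ℝ} (ht : 0 < t) :
    Tendsto (fun n => P {ω | t * b n <
      ‖partialSum (fun i ω => Xs (2 * i) ω - Xs (2 * i + 1) ω) n ω‖}) atTop (𝓝 0) := by
  have := hw.tendsto_of_isNormalizing (hab.const_mul two_pos) h.symmetrize h.isSymmetric_sub
    (h.tendsto_tail_symmetrize htail) (half_pos ht)
  simpa only [← mul_assoc, div_mul_cancel₀ t (two_ne_zero (α := ℝ))] using this

/-- Negligibility of the symmetrized sums forces the tail condition at every larger scale. -/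
lemma IsIIDSeq.tendsto_tail_of_symmetrize (h : IsIIDSeq P X Xs) (hb : Tendsto b atTop atTop)
    {t t' : ℝ} (htt : t < t')
    (hsymm : Tendsto (fun n => P {ω | t * b n <
      ‖partialSum (fun i ω => Xs (2 * i) ω - Xs (2 * i + 1) ω) n ω‖}) atTop (𝓝 0)) :
    Tendsto (tail P X (fun n => t' * b n)) atTop (𝓝 0) := by
  obtain ⟨M, hM⟩ := exists_half_le_measure_norm_le (P := P) X
  have h8 := ENNReal.Tendsto.const_mul hsymm (Or.inr (ENNReal.ofNat_ne_top (n := 8)))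
  rw [mul_zero] at h8
  refine tendsto_of_tendsto_of_tendsto_of_le_of_le' tendsto_const_nhds h8
    (Eventually.of_forall fun _ => zero_le) ?_
  have h4 : (0 : ℝ≥0∞) < 1 / 4 := by simp
  -- Once `b n ≥ M / (t' - t)`, the gap between the two scales absorbs the constant `M` lost in
  -- desymmetrizing.
  filter_upwards [hsymm.eventually (ge_mem_nhds h4),
    hb.eventually_ge_atTop (M / (t' - t))] with n hn1 hn2
  rw [div_le_iff₀ (by linarith)] at hn2
  have hterm := h.symmetrize.nat_mul_measure_le h.isSymmetric_sub n (t * b n) hn1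
  calc tail P X (fun n => t' * b n) n
      ≤ n * P {ω | t * b n + M < ‖X ω‖} := by
        refine mul_le_mul_right (measure_mono fun ω hω => ?_) _
        rw [Set.mem_ofPred_eq] at hω
        rw [Set.mem_ofPred_eq]
        linarith
    _ ≤ n * (2 * P {ω | t * b n < ‖Xs 0 ω - Xs 1 ω‖}) :=
        mul_le_mul_right (h.measure_le_two_mul_symmetrize hM _) _
    _ = 2 * (n * P {ω | t * b n < ‖Xs 0 ω - Xs 1 ω‖}) := mul_left_comm _ _ _
    _ ≤ 2 * (4 * P {ω | t * b n <
          ‖partialSum (fun i ω => Xs (2 * i) ω - Xs (2 * i + 1) ω) n ω‖}) :=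
        mul_le_mul_right hterm _
    _ = _ := by rw [← mul_assoc]; norm_num

lemma IsIIDSeq.measure_symmetrize_partialSum_le (h : IsIIDSeq P X Xs) (n : ℕ) (c : B) (s : ℝ) :
    P {ω | 2 * s < ‖partialSum (fun i ω => Xs (2 * i) ω - Xs (2 * i + 1) ω) n ω‖} ≤
      2 * P {ω | s < ‖partialSum Xs n ω - c‖} := by
  have hs : MeasurableSet {y : B | s < ‖y - c‖} := measurableSet_lt measurable_const (by fun_prop)
  have he := (h.identDistrib_partialSum (g := fun i => 2 * i)
    (fun i j hij => by simpa using hij) n).measure_mem_eq hs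
  have ho := (h.identDistrib_partialSum (g := fun i => 2 * i + 1)
    (fun i j hij => by simpa using hij) n).measure_mem_eq hs
  have hsub : {ω | 2 * s < ‖partialSum (fun i ω => Xs (2 * i) ω - Xs (2 * i + 1) ω) n ω‖} ⊆
      partialSum (fun i => Xs (2 * i)) n ⁻¹' {y | s < ‖y - c‖} ∪
        partialSum (fun i => Xs (2 * i + 1)) n ⁻¹' {y | s < ‖y - c‖} := by
    intro ω hω
    rw [Set.mem_ofPred_eq] at hω
    by_contra hcon
    simp only [Set.mem_union, Set.mem_preimage, Set.mem_ofPred_eq, not_or, not_lt] at hcon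
    have := norm_sub_le (partialSum (fun i => Xs (2 * i)) n ω - c)
      (partialSum (fun i => Xs (2 * i + 1)) n ω - c)
    rw [sub_sub_sub_cancel_right, ← partialSum_sub] at this
    linarith [hcon.1, hcon.2]
  refine (measure_mono hsub).trans ((measure_union_le _ _).trans_eq ?_)
  rw [he, ho, two_mul]
  rfl

/-- Tightness of the centered sums at one scale forces the tail condition. -/
lemma SymmetricWeakLaw.tendsto_tail (hw : SymmetricWeakLaw P B a)
    (hab : IsNormalizing a b) (h : IsIIDSeq P X Xs) (c : ℕ → B) {t : ℝ} (ht : 0 < t)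
    (hlim : Tendsto (fun n => P {ω | t * b n < ‖partialSum Xs n ω - c n‖}) atTop (𝓝 0)) :
    Tendsto (tail P X b) atTop (𝓝 0) := by
  have h2 := ENNReal.Tendsto.const_mul hlim (Or.inr (ENNReal.ofNat_ne_top (n := 2)))
  rw [mul_zero] at h2
  have hsymm : Tendsto (fun n => P {ω | 2 * t * b n <
      ‖partialSum (fun i ω => Xs (2 * i) ω - Xs (2 * i + 1) ω) n ω‖}) atTop (𝓝 0) := by
    refine tendsto_of_tendsto_of_tendsto_of_le_of_le tendsto_const_nhds h2
      (fun _ => zero_le) fun n => ?_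
    simp only [mul_assoc]
    exact h.measure_symmetrize_partialSum_le n (c n) (t * b n)
  have hbig := h.tendsto_tail_of_symmetrize hab.tendsto_right (lt_add_one (2 * t)) hsymm
  have hK : 0 < 2 * t + 1 := by linarith
  -- The tail condition at the enlarged scale already gives negligibility at every scale; the choice
  -- of `t` makes it `b n / 2`, below the target `b n`.
  have hall := hw.tendsto_symmetrize (hab.const_mul hK) h hbig
    (show 0 < 1 / 2 / (2 * t + 1) by positivity)
  simp only [← mul_assoc, div_mul_cancel₀ _ hK.ne'] at hall
  simpa using h.tendsto_tail_of_symmetrize hab.tendsto_right (t' := 1) (by norm_num) hall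

end

end WLLN

theorem theorem3p1 {Ω B : Type*} [MeasurableSpace Ω] (P : Measure Ω) [IsProbabilityMeasure P]
    [NormedAddCommGroup B] [NormedSpace ℝ B] [CompleteSpace B]
    [TopologicalSpace.SeparableSpace B] [MeasurableSpace B] [BorelSpace B]
    (a b : ℕ → ℝ)
    (ha_pos : ∀ n, 1 ≤ n → 0 < a n) (hb_pos : ∀ n, 1 ≤ n → 0 < b n)
    (ha_mono : MonotoneOn a (Set.Ici 1)) (hb_mono : MonotoneOn b (Set.Ici 1))
    (ha_lim : Tendsto a atTop atTop)
    (hba : MonotoneOn (fun n => b n / a n) (Set.Ici 1))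
    (hwlln : ∀ (X : Ω → B) (Xs : ℕ → Ω → B), WLLN.IsIIDSeq P X Xs → WLLN.IsSymmetric P X →
      (TendstoInMeasure P (fun n ω => (a n)⁻¹ • WLLN.partialSum Xs n ω) atTop (fun _ => 0) ↔
        Tendsto (WLLN.tail P X a) atTop (𝓝 0))) :
    ∀ (X : Ω → B) (Xs : ℕ → Ω → B), WLLN.IsIIDSeq P X Xs →
      (Tendsto (WLLN.tail P X b) atTop (𝓝 0) →
        TendstoInMeasure P
          (fun n ω => (b n)⁻¹ • (WLLN.partialSum Xs n ω - WLLN.gam P X b n))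
          atTop (fun _ => 0)) ∧
      (0 < limsup (WLLN.tail P X b) atTop →
        ∀ lam : ℝ, 0 < lam →
          0 < limsup
            (fun n => P {ω | lam < ‖WLLN.partialSum Xs n ω - WLLN.gam P X b n‖ / b n}) atTop) := by
  have := UniformSpace.secondCountable_of_separable B
  have hw : WLLN.SymmetricWeakLaw P B a := fun X Xs h hsym => (hwlln X Xs h hsym).2
  have hab : WLLN.IsNormalizing a b := ⟨ha_pos, hb_pos, ha_mono, ha_lim, hba⟩
  refine fun X Xs h => ⟨fun htail => ?_, fun hpos lam hlam => ?_⟩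
  · refine (WLLN.tendstoInMeasure_inv_smul_iff hb_pos _).2 fun t ht => ?_
    exact h.tendsto_of_symmetrize hb_pos htail
      (fun t ht => hw.tendsto_symmetrize hab h htail ht) ht
  · by_contra hcon
    -- For nonnegative quantities a vanishing upper limit is convergence to `0`, which would force
    -- the tail itself to vanish.
    have hlim := tendsto_of_le_liminf_of_limsup_le zero_le (not_lt.1 hcon)
    have hlim' : Tendsto (fun n => P {ω | lam * b n <
        ‖WLLN.partialSum Xs n ω - WLLN.gam P X b n‖}) atTop (𝓝 0) := by
      refine hlim.congr' ?_
      filter_upwards [eventually_ge_atTop 1] with n hn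
      simp only [lt_div_iff₀ (hb_pos n hn)]
    rw [(hw.tendsto_tail hab h _ hlam hlim').limsup_eq] at hpos
    exact lt_irrefl _ hpos
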